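/- Let $G$ be a finite group, let $X$ and $Y$ be finite $G$-sets with $Y$ nonempty, let $V=\mathbb R^X$ and $W=\mathbb R^Y$ be the associated permutation representations ($g e_x=e_{gx}$), and let $\sigma:\mathbb R\to\mathbb R$ be continuous and not a polynomial; write $\tilde\sigma$ for $\sigma$ applied entrywise. Let $M=\mathrm{Aff}_G(V,W)$ and $N=\mathrm{Aff}_G(W,\mathbb R)$ be the spaces of $G$-equivariant affine maps ($G$ acting trivially on $\mathbb R$). Let $\mathcal U(M,N)$ be the closure in $\mathcal C(V,\mathbb R)$, for uniform convergence on compact sets, of the set of all networks $x\mapsto\sum_{k=1}^h g_k(\tilde\sigma(f_k(x)))$ with $h\in\mathbb N$, $f_k\in M$, $g_k\in N$. For a family $\mathcal F\subseteq\mathcal C(V,\mathbb R)$ let $\rho(\mathcal F)$ be the set of pairs $(x,y)$ with $f(x)=f(y)$ for all $f\in\mathcal F$; $\mathcal F$ is separation-constrained universal if its closure is the set $\mathcal C_{\rho(\mathcal F)}$ of all continuous $f:V\to\mathbb R$ with $f(x)=f(y)$ for all $(x,y)\in\rho(\mathcal F)$. Let $\ell=|Y|\ge 1$ and identify $Y$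 with $\{1,\dots,\ell\}$. Let $\phi^1,\dots,\phi^m$ be a basis of the linear part $\mathrm{Hom}_G(V,W)$ of $M$, and let $\phi_i:V\to\mathbb R^m$, $\phi_i(x)=(\phi^1_i(x),\dots,\phi^m_i(x))$, $i=1,\dots,\ell$, be its basis maps. Let $i\mapsto\alpha_i\in X$ be a $G$-equivariant map $Y\to X$, i.e. one for which $x\mapsto(e_{\alpha_1}^\top x,\dots,e_{\alpha_\ell}^\top x)$ belongs to $\mathrm{Hom}_G(V,W)$. Let $s_1,\dots,s_\ell\in\{0,\dots,\ell\}$ be integers with $s_1+\dots+s_\ell=\ell$; let $a_1,\dots,a_\ell$ be integers with $a_1>\ell$ and $a_i+\ell<a_{i+1}$ for $1\le i<\ell$; and let $c_i\in V$ with $\phi_i(c_i)=0$ for $i=1,\dots,\ell$. Put $c_{i,j}=e_{\alpha_j}^\top c_i$ and $t_j=s_1+\dots+s_j$ (with $t_0=0$). If $$\sum_{\tau\in S_\ell}\ \Bigl(\prod_{j:\,s_j\ne0}\frac{a_j!}{s_j!}\Bigr)\prod_{j=1}^{\ell}\ \prod_{p=t_{j-1}+1}^{t_j}c_{\tau(p),j}\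 \neq\ 0,$$ then $\mathcal U(M,N)$ is not separation-constrained universal. More precisely, the symmetrized monomial $$F(x)=\sum_{\tau\in S_\ell}\prod_{j=1}^{\ell}\bigl(e_{\alpha_{\tau(j)}}^\top x\bigr)^{a_j}$$ belongs to $\mathcal C_{\rho(\mathcal U(M,N))}$ but not to $\mathcal U(M,N)$. -/

import Mathlib

/-! ### Permutation representations and equivariant layers -/

/-- The permutation representation of `G` on `ℝ^X`, characterised by `g e_x = e_{g x}`
(see `permRep_single`). -/
def permRep (G : Type*) [Group G] (X : Type*) [MulAction G X] :
    Representation ℝ G (X → ℝ) where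
  toFun g := LinearMap.funLeft ℝ ℝ (fun x : X => g⁻¹ • x)
  map_one' := by
    ext v x
    simp [LinearMap.funLeft_apply]
  map_mul' g h := by
    ext v x
    simp [LinearMap.funLeft_apply, mul_smul]

theorem permRep_single {G : Type*} [Group G] {X : Type*} [MulAction G X] [DecidableEq X]
    (g : G) (x : X) :
    permRep G X g (Pi.single x 1) = Pi.single (g • x) 1 := by
  ext z
  simp only [permRep, MonoidHom.coe_mk, OneHom.coe_mk, LinearMap.funLeft_apply, Pi.single_apply,
    inv_smul_eq_iff]

/-- `Aff_G(V, W)`: the affine maps commuting with the action of `G`. -/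
def affG {G V W : Type*} [Group G] [AddCommGroup V] [Module ℝ V] [AddCommGroup W] [Module ℝ W]
    (rV : Representation ℝ G V) (rW : Representation ℝ G W) : Submodule ℝ (V →ᵃ[ℝ] W) where
  carrier := {f | ∀ g v, f (rV g v) = rW g (f v)}
  add_mem' := by
    intro f f' hf hf' g v
    simp [hf g v, hf' g v]
  zero_mem' := by
    intro g v
    simp
  smul_mem' := by
    intro r f hf g v
    simp [hf g v]

/-- The linear part of a space of affine maps. -/
def linearPart {V W : Type*} [AddCommGroup V] [Module ℝ V] [AddCommGroup W] [Module ℝ W]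
    (M : Submodule ℝ (V →ᵃ[ℝ] W)) : Submodule ℝ (V →ₗ[ℝ] W) where
  carrier := {φ | ∃ f ∈ M, f.linear = φ}
  add_mem' := by
    rintro _ _ ⟨f, hf, rfl⟩ ⟨f', hf', rfl⟩
    exact ⟨f + f', M.add_mem hf hf', rfl⟩
  zero_mem' := ⟨0, M.zero_mem, rfl⟩
  smul_mem' := by
    rintro r _ ⟨f, hf, rfl⟩
    exact ⟨r • f, M.smul_mem r hf, rfl⟩

/-- The basis map `φ_y : V → ℝ^m`, `φ_y(v) = (φ^1_y(v), …, φ^m_y(v))`, attached to a basis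
`φ^1, …, φ^m` of the linear part of `M ⊆ Aff(V, ℝ^Y)`. -/
noncomputable def basisMap {V Y : Type*} [AddCommGroup V] [Module ℝ V] {m : ℕ}
    {M : Submodule ℝ (V →ᵃ[ℝ] (Y → ℝ))} (φ : Module.Basis (Fin m) ℝ (linearPart M)) (y : Y) :
    V →ₗ[ℝ] (Fin m → ℝ) :=
  LinearMap.pi fun t => (LinearMap.proj y).comp (φ t : V →ₗ[ℝ] (Y → ℝ))

/-! ### Shallow neural spaces and universality classes -/

/-- `M_h`: the maps `x ↦ (f_1(x), …, f_h(x))` with all `f_k ∈ M`. -/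
def parallelLayer {V W : Type*} [AddCommGroup V] [Module ℝ V] [AddCommGroup W] [Module ℝ W]
    (M : Submodule ℝ (V →ᵃ[ℝ] W)) (h : ℕ) : Set (V →ᵃ[ℝ] (Fin h → W)) :=
  {F | ∃ f : Fin h → (V →ᵃ[ℝ] W), (∀ k, f k ∈ M) ∧ ∀ x k, F x k = f k x}

/-- `_hN`: the maps `(x_1, …, x_h) ↦ g_1(x_1) + ⋯ + g_h(x_h)` with all `g_k ∈ N`. -/
def summedLayer {W Z : Type*} [AddCommGroup W] [Module ℝ W] [AddCommGroup Z] [Module ℝ Z]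
    (N : Submodule ℝ (W →ᵃ[ℝ] Z)) (h : ℕ) : Set ((Fin h → W) →ᵃ[ℝ] Z) :=
  {F | ∃ g : Fin h → (W →ᵃ[ℝ] Z), (∀ k, g k ∈ N) ∧ ∀ w, F w = ∑ k, g k (w k)}

/-- The shallow neural space `N_σ(M_h, _hN)`, where `σ` acts entrywise on
`ℝ^Y ⊗ ℝ^h = (ℝ^Y)^h`. -/
def neuralSpace {V Y Z : Type*} [AddCommGroup V] [Module ℝ V] [TopologicalSpace V]
    [AddCommGroup Z] [Module ℝ Z] [TopologicalSpace Z] (σ : ℝ → ℝ)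
    (M : Submodule ℝ (V →ᵃ[ℝ] (Y → ℝ))) (N : Submodule ℝ ((Y → ℝ) →ᵃ[ℝ] Z)) (h : ℕ) :
    Set C(V, Z) :=
  {η | ∃ f ∈ parallelLayer M h, ∃ g ∈ summedLayer N h,
    ∀ x, η x = g (fun k y => σ (f x k y))}

/-- The universality class `U(M, N)`: the closure, for uniform convergence on compact sets,
of the union over all widths of the shallow neural spaces. -/
def universalityClass {V Y Z : Type*} [AddCommGroup V] [Module ℝ V] [TopologicalSpace V]
    [AddCommGroup Z] [Module ℝ Z] [TopologicalSpace Z] (σ : ℝ → ℝ)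
    (M : Submodule ℝ (V →ᵃ[ℝ] (Y → ℝ))) (N : Submodule ℝ ((Y → ℝ) →ᵃ[ℝ] Z)) :
    Set C(V, Z) :=
  closure (⋃ h : ℕ, neuralSpace σ M N h)

/-! ### Separation -/

/-- `ρ(F)`: the pairs of points that no member of the family `F` separates. -/
def separationRel {A B : Type*} [TopologicalSpace A] [TopologicalSpace B] (F : Set C(A, B)) :
    Set (A × A) :=
  {p | ∀ f ∈ F, f p.1 = f p.2}

/-- `C_ρ(A, B)`: the continuous functions that respect the relation `R`. -/
def respecting {A : Type*} (B : Type*) [TopologicalSpace A] [TopologicalSpace B]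
    (R : Set (A × A)) : Set C(A, B) :=
  {f | ∀ p ∈ R, f p.1 = f p.2}

/-- A family of continuous functions is separation-constrained universal if its closure consists
of all continuous functions that respect its separation relation. -/
def IsSeparationConstrainedUniversal {A B : Type*} [TopologicalSpace A] [TopologicalSpace B]
    (F : Set C(A, B)) : Prop :=
  closure F = respecting B (separationRel F)

/-! ### The combinatorial expression and the symmetrized monomial -/

/-- The `j`-th of the consecutive blocks, of sizes `s_1, s_2, …`, into which the positions
`1, …, ℓ` are cut: the positions `p` with `s_1 + ⋯ + s_{j-1} < p ≤ s_1 + ⋯ + s_j`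
(counted from `1`). -/
def block {ℓ : ℕ} (s : Fin ℓ → ℕ) (j : Fin ℓ) : Finset (Fin ℓ) :=
  Finset.univ.filter fun p =>
    (∑ k ∈ Finset.Iio j, s k) ≤ (p : ℕ) ∧ (p : ℕ) < ∑ k ∈ Finset.Iic j, s k

/-- The sum over all permutations `τ` of
`∏_{s_j ≠ 0} (a_j! / s_j!) · ∏_j ∏_{p in the j-th block} C_{τ(p), j}`. -/
noncomputable def combinatorialSum {ℓ : ℕ} (s a : Fin ℓ → ℕ) (C : Fin ℓ → Fin ℓ → ℝ) : ℝ :=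
  ∑ τ : Equiv.Perm (Fin ℓ),
    (∏ j ∈ Finset.univ.filter (fun j => s j ≠ 0),
      ((a j).factorial : ℝ) / ((s j).factorial : ℝ)) *
    ∏ j, ∏ p ∈ block s j, C (τ p) j

/-- The symmetrized monomial `x ↦ ∑_τ ∏_j (x_{α_{τ(j)}})^{a_j}` on `ℝ^X`. -/
def symmetrizedMonomial {X : Type*} {ℓ : ℕ} (α : Fin ℓ → X) (a : Fin ℓ → ℕ) :
    C(X → ℝ, ℝ) where
  toFun x := ∑ τ : Equiv.Perm (Fin ℓ), ∏ j, x (α (τ j)) ^ a j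
  continuous_toFun := by fun_prop

/-!
A one-layer network `x ↦ ∑_y σ(r x_{α y} + b)` cannot separate a `ρ`-related pair `x`, `x'`, so
the two points have equal ridge sums for all `r` and `b`. After mollifying `σ` and differentiating
`k` times in `r` at `0`, either `σ` is a polynomial of degree `< k` or the `k`-th power sums of
the `x_{α y}` and `x'_{α y}` agree. Hence these values agree up to a permutation, and `F` does not
separate `x` from `x'` either.

On the other hand `c_i ∈ ker φ_i` makes the `i`-th coordinate of every `f ∈ M` invariant under
translation by `c_i`, so the iterated difference `Δ_{c_1} ⋯ Δ_{c_ℓ}` annihilates all networks, and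
by continuity all of `U(M, N)`. For a polynomial `p`, `Δ_c p = 0` forces `D_c p = 0`, and `D_c`
commutes with differences, so the differences can be traded one by one for directional
derivatives. If `c` has a nonzero entry at some `α_j`, then `D_c` is injective on the polynomials
divisible by `x_{α_j}`, and it lowers the exponents of the `x_{α_j}` by at most one. As `F ≠ 0` is
divisible by the `ℓ`-th powers of all `x_{α_j}`, it is not annihilated. That every `c_i` has such
an entry is what the nonvanishing of the combinatorial expression provides.
-/

/-! ### Power sums and non-polynomial activation functions -/

theorem sum_comp_eq_of_sum_pow_eq {K ι : Type*} [Field K] [Fintype ι] {t u : ι → K}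
    (h : ∀ k : ℕ, ∑ i, t i ^ k = ∑ i, u i ^ k) (φ : K → K) :
    ∑ i, φ (t i) = ∑ i, φ (u i) := by
  obtain ⟨p, hp⟩ := (Polynomial.exists_eval_eq_iff (Sum.elim t u) (φ ∘ Sum.elim t u)).2
    fun _ _ hij => congrArg φ hij
  have sum_eval (v : ι → K) :
      ∑ i, p.eval (v i) = ∑ k ∈ Finset.range (p.natDegree + 1), p.coeff k * ∑ i, v i ^ k := by
    simp_rw [Polynomial.eval_eq_sum_range, Finset.mul_sum]
    exact Finset.sum_comm
  calc ∑ i, φ (t i) = ∑ i, p.eval (t i) := Finset.sum_congr rfl fun i _ => (hp (.inl i)).symm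
    _ = ∑ i, p.eval (u i) := by simp only [sum_eval, h]
    _ = ∑ i, φ (u i) := Finset.sum_congr rfl fun i _ => hp (.inr i)

theorem exists_perm_of_sum_pow_eq {K ι : Type*} [Field K] [CharZero K] [Fintype ι] {t u : ι → K}
    (h : ∀ k : ℕ, ∑ i, t i ^ k = ∑ i, u i ^ k) : ∃ π : Equiv.Perm ι, ∀ i, u (π i) = t i := by
  classical
  have card_fiber_eq (v : K) : Fintype.card {i // t i = v} = Fintype.card {i // u i = v} := by
    have := sum_comp_eq_of_sum_pow_eq h fun x => if x = v then 1 else 0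
    simpa only [Finset.sum_boole, Nat.cast_inj, ← Fintype.card_subtype] using this
  exact ⟨Equiv.ofFiberEquiv fun v => Fintype.equivOfCardEq (card_fiber_eq v),
    Equiv.ofFiberEquiv_map _⟩

theorem exists_polynomial_of_iteratedDeriv_eq_zero {f : ℝ → ℝ} {k : ℕ} (hf : ContDiff ℝ k f)
    (h : iteratedDeriv k f = 0) : ∃ p ∈ Polynomial.degreeLT ℝ k, ∀ x, p.eval x = f x := by
  rcases k with _ | n
  · exact ⟨0, Submodule.zero_mem _, fun x => by simpa using (congrFun h x).symm⟩
  let T (y x : ℝ) : ℝ := taylorWithinEval f n Set.univ y x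
  have hasDerivAt_base (x y : ℝ) : HasDerivAt (fun y => T y x) 0 y := by
    have hdiff : Differentiable ℝ (iteratedDeriv n f) :=
      hf.differentiable_iteratedDeriv n (by exact_mod_cast n.lt_succ_self)
    have := hasDerivWithinAt_taylorWithinEval (x := x) uniqueDiffOn_univ Filter.univ_mem
      (Set.mem_univ y) subset_rfl (hf.of_le (by exact_mod_cast n.le_succ)).contDiffOn
      (by simpa only [iteratedDerivWithin_univ] using (hdiff y).differentiableWithinAt)
    simpa only [iteratedDerivWithin_univ, h, Pi.zero_apply, smul_zero,
      hasDerivWithinAt_univ] using this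
  refine ⟨∑ k ∈ Finset.range (n + 1),
    Polynomial.monomial k ((k.factorial : ℝ)⁻¹ * iteratedDerivWithin k f Set.univ 0), ?_,
    fun x => ?_⟩
  · refine Submodule.sum_mem _ fun k hk => Polynomial.mem_degreeLT.2 ?_
    exact (Polynomial.degree_monomial_le _ _).trans_lt (by exact_mod_cast Finset.mem_range.1 hk)
  · calc _ = T 0 x := by
          simp [T, taylor_within_apply, Polynomial.eval_finsetSum, mul_right_comm]
      _ = T x x := is_const_of_deriv_eq_zero (fun y => (hasDerivAt_base x y).differentiableAt)
          (fun y => (hasDerivAt_base x y).deriv) 0 x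
      _ = f x := taylorWithinEval_self f n Set.univ x

theorem isClosed_setOf_polynomial_degreeLT (𝕜 : Type*) [NontriviallyNormedField 𝕜]
    [CompleteSpace 𝕜] (k : ℕ) :
    IsClosed {f : 𝕜 → 𝕜 | ∃ p ∈ Polynomial.degreeLT 𝕜 k, ∀ x, p.eval x = f x} := by
  let ev : Polynomial 𝕜 →ₗ[𝕜] (𝕜 → 𝕜) := LinearMap.pi Polynomial.leval
  have : FiniteDimensional 𝕜 (Polynomial.degreeLT 𝕜 k) :=
    (Polynomial.degreeLTEquiv 𝕜 k).symm.finiteDimensional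
  convert ((Polynomial.degreeLT 𝕜 k).map ev).closed_of_finiteDimensional using 1
  ext f
  simp [ev, funext_iff]

-- Differentiate the relation `k` times in `r` at `r = 0`.
theorem iteratedDeriv_eq_zero_of_ridge_relation {𝕜 ι : Type*} [NontriviallyNormedField 𝕜]
    [Fintype ι] {t w : ι → 𝕜} {k : ℕ} {f : 𝕜 → 𝕜} (hf : ContDiff 𝕜 k f)
    (hrel : ∀ r b, ∑ i, w i * f (r * t i + b) = 0) (hw : ∑ i, w i * t i ^ k ≠ 0) :
    iteratedDeriv k f = 0 := by
  funext b
  have hshift : ContDiff 𝕜 k fun z => f (z + b) := by fun_prop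
  have hterm (i : ι) : iteratedDeriv k (fun r => w i * f (t i * r + b)) 0 =
      w i * t i ^ k * iteratedDeriv k f b := by
    rw [iteratedDeriv_const_mul_field,
      iteratedDeriv_comp_const_mul (f := fun z => f (z + b)) hshift, iteratedDeriv_comp_add_const]
    simp [mul_assoc]
  have hsum : (∑ i, w i * t i ^ k) * iteratedDeriv k f b = 0 := by
    calc _ = ∑ i, iteratedDeriv k (fun r => w i * f (t i * r + b)) 0 := by
          simp_rw [hterm, Finset.sum_mul]
      _ = iteratedDeriv k (fun r => ∑ i, w i * f (t i * r + b)) 0 :=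
          (iteratedDeriv_fun_sum fun i _ => by fun_prop).symm
      _ = 0 := by simp [mul_comm (t _), hrel]
  exact (mul_eq_zero.1 hsum).resolve_left hw

section RidgeRelation

variable {ι : Type*} [Fintype ι] {t w : ι → ℝ} {k : ℕ} {f : ℝ → ℝ}

open scoped Convolution in
theorem ridge_relation_convolution {g : ℝ → ℝ} (hg : Continuous g) (hg' : HasCompactSupport g)
    (hf : MeasureTheory.LocallyIntegrable f)
    (hrel : ∀ r b, ∑ i, w i * f (r * t i + b) = 0) (r b : ℝ) :
    ∑ i, w i * (g ⋆[ContinuousLinearMap.lsmul ℝ ℝ] f) (r * t i + b) = 0 := by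
  have hint (i : ι) : MeasureTheory.Integrable fun s => w i * (g s * f (r * t i + b - s)) :=
    (hg'.convolutionExists_left (ContinuousLinearMap.lsmul ℝ ℝ) hg hf _).const_mul (w i)
  calc _ = ∑ i, ∫ s, w i * (g s * f (r * t i + b - s)) :=
        Finset.sum_congr rfl fun i _ => (MeasureTheory.integral_const_mul _ _).symm
    _ = ∫ s, ∑ i, w i * (g s * f (r * t i + b - s)) :=
        (MeasureTheory.integral_finsetSum _ fun i _ => hint i).symm
    _ = ∫ s, g s * ∑ i, w i * f (r * t i + (b - s)) := by
        simp only [Finset.mul_sum, add_sub_assoc, mul_left_comm]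
    _ = 0 := by simp [hrel]

-- Mollification reduces to smooth `f`; the degree bound is what survives the limit.
open Filter Topology in
open scoped Convolution in
theorem exists_polynomial_of_ridge_relation (hf : Continuous f)
    (hrel : ∀ r b, ∑ i, w i * f (r * t i + b) = 0) (hw : ∑ i, w i * t i ^ k ≠ 0) :
    ∃ p ∈ Polynomial.degreeLT ℝ k, ∀ x, p.eval x = f x := by
  let bump (n : ℕ) : ContDiffBump (0 : ℝ) :=
    { rIn := 1 / (n + 1) / 2
      rOut := 1 / (n + 1)
      rIn_pos := by positivity
      rIn_lt_rOut := half_lt_self (by positivity) }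
  let mollified (n : ℕ) : ℝ → ℝ :=
    (bump n).normed MeasureTheory.volume ⋆[ContinuousLinearMap.lsmul ℝ ℝ] f
  have tendsto_mollified : Tendsto mollified atTop (𝓝 f) := tendsto_pi_nhds.2
    (ContDiffBump.convolution_tendsto_right_of_continuous
      tendsto_one_div_add_atTop_nhds_zero_nat hf)
  refine (isClosed_setOf_polynomial_degreeLT ℝ k).mem_of_tendsto tendsto_mollified
    (Eventually.of_forall fun n => ?_)
  have hsmooth : ContDiff ℝ k (mollified n) :=
    (bump n).hasCompactSupport_normed.contDiff_convolution_left _ (bump n).contDiff_normed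
      hf.locallyIntegrable
  exact exists_polynomial_of_iteratedDeriv_eq_zero hsmooth
    (iteratedDeriv_eq_zero_of_ridge_relation hsmooth
      (ridge_relation_convolution (bump n).continuous_normed (bump n).hasCompactSupport_normed
        hf.locallyIntegrable hrel) hw)

end RidgeRelation

theorem exists_perm_of_sum_ridge_eq {ι : Type*} [Fintype ι] {t u : ι → ℝ} {f : ℝ → ℝ}
    (hf : Continuous f) (hpoly : ¬ ∃ p : Polynomial ℝ, ∀ x, f x = p.eval x)
    (h : ∀ r b, ∑ i, f (r * t i + b) = ∑ i, f (r * u i + b)) :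
    ∃ π : Equiv.Perm ι, ∀ i, u (π i) = t i := by
  refine exists_perm_of_sum_pow_eq fun k => ?_
  by_contra hk
  obtain ⟨p, -, hp⟩ := exists_polynomial_of_ridge_relation (t := Sum.elim t u)
    (w := Sum.elim (fun _ => 1) fun _ => -1) (k := k) hf (by simp [h])
    (by simpa [← sub_eq_add_neg, sub_ne_zero] using hk)
  exact hpoly ⟨p, fun x => (hp x).symm⟩

/-! ### Iterated differences -/

section IteratedFwdDiff

variable {V Z : Type*} [AddCommGroup V] [AddCommGroup Z]

/-- The iterated difference `Δ_{v_1} ⋯ Δ_{v_n} f` along a list of increments, where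
`Δ_v f(x) = f(x + v) - f(x)`. -/
def iteratedFwdDiff (L : List V) (f : V → Z) : V → Z := L.foldr fwdDiff f

theorem iteratedFwdDiff_cons (v : V) (L : List V) (f : V → Z) :
    iteratedFwdDiff (v :: L) f = fwdDiff v (iteratedFwdDiff L f) :=
  rfl

theorem iteratedFwdDiff_fwdDiff (v : V) (L : List V) (f : V → Z) :
    iteratedFwdDiff L (fwdDiff v f) = fwdDiff v (iteratedFwdDiff L f) := by
  induction L with
  | nil => rfl
  | cons u L ih =>
    rw [iteratedFwdDiff_cons, iteratedFwdDiff_cons, ih]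
    funext x
    simp only [fwdDiff, add_right_comm x u v]
    abel

theorem iteratedFwdDiff_zero (L : List V) : iteratedFwdDiff L (0 : V → Z) = 0 := by
  induction L with
  | nil => rfl
  | cons v L ih =>
    rw [iteratedFwdDiff_cons, ih]
    exact fwdDiff_const v 0

theorem iteratedFwdDiff_add (L : List V) (f g : V → Z) :
    iteratedFwdDiff L (f + g) = iteratedFwdDiff L f + iteratedFwdDiff L g := by
  induction L with
  | nil => rfl
  | cons v L ih => simp only [iteratedFwdDiff_cons, ih, fwdDiff_add]

theorem iteratedFwdDiff_finsetSum {ι : Type*} (S : Finset ι) (L : List V) (f : ι → V → Z) :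
    iteratedFwdDiff L (∑ i ∈ S, f i) = ∑ i ∈ S, iteratedFwdDiff L (f i) := by
  induction L with
  | nil => rfl
  | cons v L ih => simp only [iteratedFwdDiff_cons, ih, fwdDiff_finsetSum]

theorem iteratedFwdDiff_eq_zero_of_mem {L : List V} {v : V} (hv : v ∈ L) {f : V → Z}
    (hf : fwdDiff v f = 0) : iteratedFwdDiff L f = 0 := by
  induction L with
  | nil => simp at hv
  | cons u L ih =>
    rcases List.mem_cons.1 hv with rfl | hv
    · rw [iteratedFwdDiff_cons, ← iteratedFwdDiff_fwdDiff, hf, iteratedFwdDiff_zero]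
    · rw [iteratedFwdDiff_cons, ih hv]
      exact fwdDiff_const u 0

theorem continuous_iteratedFwdDiff_apply [TopologicalSpace Z] [IsTopologicalAddGroup Z]
    (L : List V) (x : V) : Continuous fun f : V → Z => iteratedFwdDiff L f x := by
  induction L generalizing x with
  | nil => exact continuous_apply x
  | cons v L ih => exact (ih (x + v)).sub (ih x)

end IteratedFwdDiff

/-! ### Directional derivatives and differences of multivariate polynomials -/

section MvPolynomial

open MvPolynomial

variable {ι R : Type*} [CommRing R]

/-- The derivative of a polynomial in the constant direction `c`. -/
noncomputable def dirDeriv (c : ι → R) : Derivation R (MvPolynomial ι R) (MvPolynomial ι R) :=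
  mkDerivation R fun i => C (c i)

/-- The translation `p ↦ p(x + c)` of polynomials. -/
noncomputable def polyTranslate (c : ι → R) : MvPolynomial ι R →ₐ[R] MvPolynomial ι R :=
  aeval fun i => X i + C (c i)

/-- The difference operator `p ↦ p(x + c) - p(x)` on polynomials. -/
noncomputable def polyDiff (c : ι → R) : Module.End R (MvPolynomial ι R) :=
  (polyTranslate c).toLinearMap - 1

/-- The restriction `p ↦ p(x + T c)` of a polynomial to the line through `x` in direction `c`, as
a polynomial in the parameter `T` of that line. -/
noncomputable def lineRestriction (x c : ι → R) : MvPolynomial ι R →ₐ[R] Polynomial R :=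
  aeval fun i => Polynomial.C (x i) + Polynomial.C (c i) * Polynomial.X

theorem eval_polyTranslate (c x : ι → R) (p : MvPolynomial ι R) :
    eval x (polyTranslate c p) = eval (x + c) p := by
  induction p using MvPolynomial.induction_on <;> simp_all [polyTranslate]

theorem dirDeriv_polyTranslate (c d : ι → R) (p : MvPolynomial ι R) :
    dirDeriv d (polyTranslate c p) = polyTranslate c (dirDeriv d p) := by
  induction p using MvPolynomial.induction_on <;>
    simp_all [polyTranslate, dirDeriv, Derivation.leibniz, mkDerivation_X]

theorem eval_lineRestriction (x c : ι → R) (p : MvPolynomial ι R) (r : R) :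
    (lineRestriction x c p).eval r = eval (x + r • c) p := by
  induction p using MvPolynomial.induction_on <;> simp_all [lineRestriction, mul_comm r]

theorem derivative_lineRestriction (x c : ι → R) (p : MvPolynomial ι R) :
    (lineRestriction x c p).derivative = lineRestriction x c (dirDeriv c p) := by
  induction p using MvPolynomial.induction_on with
  | C a => simp [lineRestriction, dirDeriv]
  | add p q hp hq => simp_all
  | mul_X p i hp =>
    simp_all [lineRestriction, dirDeriv, Derivation.leibniz, mkDerivation_X]
    ring

theorem dirDeriv_polyDiff_prod (c : ι → R) (L : List (ι → R)) (p : MvPolynomial ι R) :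
    dirDeriv c ((L.map polyDiff).prod p) = (L.map polyDiff).prod (dirDeriv c p) := by
  induction L with
  | nil => simp
  | cons d L ih => simp [polyDiff, dirDeriv_polyTranslate, ← ih]

theorem fwdDiff_eval (c : ι → R) (p : MvPolynomial ι R) :
    fwdDiff c (fun x => eval x p) = fun x => eval x (polyDiff c p) := by
  funext x
  simp [fwdDiff, polyDiff, eval_polyTranslate]

theorem iteratedFwdDiff_eval (L : List (ι → R)) (p : MvPolynomial ι R) :
    iteratedFwdDiff L (fun x => eval x p) = fun x => eval x ((L.map polyDiff).prod p) := by
  induction L with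
  | nil => simp [iteratedFwdDiff]
  | cons c L ih => simp [iteratedFwdDiff_cons, ih, fwdDiff_eval]

theorem X_pow_dvd_dirDeriv (c : ι → R) {p : MvPolynomial ι R} {i : ι} {k : ℕ}
    (h : X i ^ (k + 1) ∣ p) : X i ^ k ∣ dirDeriv c p := by
  obtain ⟨q, rfl⟩ := h
  rw [Derivation.leibniz, Derivation.leibniz_pow]
  refine dvd_add ((pow_dvd_pow _ k.le_succ).mul_right _) ?_
  simp only [Nat.add_sub_cancel, smul_eq_mul, nsmul_eq_mul]
  exact (((dvd_refl _).mul_right _).mul_left _).mul_left _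

-- A polynomial on the line that takes the same value at all natural numbers is constant.
theorem dirDeriv_eq_zero_of_polyDiff_eq_zero [IsDomain R] [CharZero R] {c : ι → R}
    {p : MvPolynomial ι R} (h : polyDiff c p = 0) : dirDeriv c p = 0 := by
  have : Infinite R := .of_injective _ Nat.cast_injective
  refine MvPolynomial.funext fun x => ?_
  have eval_step (y : ι → R) : eval (y + c) p = eval y p := by
    rw [← eval_polyTranslate, ← sub_eq_zero, ← map_sub]
    exact (congrArg (eval y) h).trans (map_zero _)
  have eval_nat (n : ℕ) : (lineRestriction x c p).eval (n : R) = eval x p := by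
    induction n with
    | zero => simp [eval_lineRestriction]
    | succ n ih =>
      rw [eval_lineRestriction, Nat.cast_succ, add_smul, one_smul, ← add_assoc, eval_step,
        ← eval_lineRestriction, ih]
  have hconst : lineRestriction x c p = Polynomial.C (eval x p) :=
    Polynomial.eq_of_infinite_eval_eq _ _ <|
      (Set.infinite_range_of_injective Nat.cast_injective).mono <| by
        rintro _ ⟨n, rfl⟩
        simpa using eval_nat n
  calc eval x (dirDeriv c p) = (lineRestriction x c p).derivative.eval 0 := by
        rw [derivative_lineRestriction, eval_lineRestriction, zero_smul, add_zero]
    _ = eval x 0 := by rw [hconst, Polynomial.derivative_C, Polynomial.eval_zero, map_zero]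

-- On each line in direction `c` the polynomial is constant, and it vanishes where `x i = 0`.
theorem eq_zero_of_X_dvd_of_dirDeriv_eq_zero {K : Type*} [Field K] [CharZero K] {c : ι → K}
    {p : MvPolynomial ι K} {i : ι} (hc : c i ≠ 0) (hp : X i ∣ p) (h : dirDeriv c p = 0) :
    p = 0 := by
  refine MvPolynomial.funext fun x => ?_
  have hconst : lineRestriction x c p = Polynomial.C ((lineRestriction x c p).coeff 0) :=
    Polynomial.eq_C_of_derivative_eq_zero (by rw [derivative_lineRestriction, h, map_zero])
  have eval_line (r : K) : eval (x + r • c) p = (lineRestriction x c p).coeff 0 := by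
    rw [← eval_lineRestriction, hconst, Polynomial.eval_C, Polynomial.coeff_C_zero]
  obtain ⟨q, rfl⟩ := hp
  calc eval x (X i * q) = eval (x + (0 : K) • c) (X i * q) := by rw [zero_smul, add_zero]
    _ = eval (x + (-(x i / c i)) • c) (X i * q) := by rw [eval_line, eval_line]
    _ = eval x 0 := by simp [hc]

theorem eq_zero_of_polyDiff_prod_eq_zero {K : Type*} [Field K] [CharZero K] {A : Set ι}
    {L : List (ι → K)} {p : MvPolynomial ι K} (hp : ∀ i ∈ A, X i ^ L.length ∣ p)
    (hL : ∀ c ∈ L, ∃ i ∈ A, c i ≠ 0) (h : (L.map polyDiff).prod p = 0) : p = 0 := by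
  induction L generalizing p with
  | nil => simpa using h
  | cons c L ih =>
    obtain ⟨i, hiA, hci⟩ := hL c List.mem_cons_self
    have hdiff : (L.map polyDiff).prod (dirDeriv c p) = 0 := by
      rw [← dirDeriv_polyDiff_prod]
      exact dirDeriv_eq_zero_of_polyDiff_eq_zero (by simpa using h)
    have hderiv : dirDeriv c p = 0 :=
      ih (fun j hj => X_pow_dvd_dirDeriv c (hp j hj)) (fun d hd => hL d (.tail _ hd)) hdiff
    exact eq_zero_of_X_dvd_of_dirDeriv_eq_zero hci ((dvd_pow_self _ (by simp)).trans (hp i hiA))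
      hderiv

end MvPolynomial

/-! ### Networks -/

theorem affineMap_pi_apply_eq_sum {R Y Z : Type*} [Ring R] [AddCommGroup Z] [Module R Z]
    [Fintype Y] [DecidableEq Y] (g : (Y → R) →ᵃ[R] Z) (w : Y → R) :
    g w = ∑ y, w y • g.linear (Pi.single y 1) + g 0 := by
  have linear_apply : g.linear w = ∑ y, w y • g.linear (Pi.single y 1) := by
    simp [LinearMap.pi_apply_eq_sum_univ g.linear w, Pi.single_comm, ← Pi.single_apply]
  rw [← linear_apply, g.decomp']
  simp

section Networks

variable {V Y Z : Type*} [AddCommGroup V] [Module ℝ V] [AddCommGroup Z] [Module ℝ Z]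

theorem mem_neuralSpace_iff [TopologicalSpace V] [TopologicalSpace Z] {σ : ℝ → ℝ}
    {M : Submodule ℝ (V →ᵃ[ℝ] (Y → ℝ))} {N : Submodule ℝ ((Y → ℝ) →ᵃ[ℝ] Z)} {h : ℕ}
    {η : C(V, Z)} :
    η ∈ neuralSpace σ M N h ↔ ∃ (f : Fin h → V →ᵃ[ℝ] (Y → ℝ)) (g : Fin h → (Y → ℝ) →ᵃ[ℝ] Z),
      (∀ k, f k ∈ M) ∧ (∀ k, g k ∈ N) ∧ ∀ x, η x = ∑ k, g k fun y => σ (f k x y) := by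
  constructor
  · rintro ⟨F, ⟨f, hf, hF⟩, H, ⟨g, hg, hH⟩, hη⟩
    exact ⟨f, g, hf, hg, fun x => by simp only [hη, hH, hF]⟩
  · rintro ⟨f, g, hf, hg, hη⟩
    let H : (Fin h → Y → ℝ) →ᵃ[ℝ] Z :=
      { toFun w := ∑ k, g k (w k)
        linear := ∑ k, (g k).linear ∘ₗ LinearMap.proj k
        map_vadd' w v := by
          simp only [Pi.vadd_apply', AffineMap.map_vadd]
          simp [Finset.sum_add_distrib] }
    exact ⟨AffineMap.pi f, ⟨f, hf, fun _ _ => rfl⟩, H, ⟨g, hg, fun _ => rfl⟩, hη⟩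

theorem linear_apply_eq_zero_of_mem_ker_basisMap {m : ℕ} {M : Submodule ℝ (V →ᵃ[ℝ] (Y → ℝ))}
    (φ : Module.Basis (Fin m) ℝ (linearPart M)) {y : Y} {c : V}
    (hc : c ∈ LinearMap.ker (basisMap φ y)) {f : V →ᵃ[ℝ] (Y → ℝ)} (hf : f ∈ M) :
    f.linear c y = 0 := by
  let evalAt : linearPart M →ₗ[ℝ] ℝ :=
    LinearMap.proj y ∘ₗ LinearMap.applyₗ c ∘ₗ (linearPart M).subtype
  have evalAt_eq_zero : evalAt = 0 := φ.ext fun t => congrFun (LinearMap.mem_ker.1 hc) t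
  exact LinearMap.congr_fun evalAt_eq_zero ⟨f.linear, f, hf, rfl⟩

-- The layer is a combination of the neurons `x ↦ σ (f x y)`, each invariant under some `v ∈ L`.
theorem iteratedFwdDiff_layer_eq_zero [Finite Y] [Nonempty Y] (σ : ℝ → ℝ) {L : List V}
    {f : V →ᵃ[ℝ] (Y → ℝ)} (hL : ∀ y, ∃ v ∈ L, f.linear v y = 0) (g : (Y → ℝ) →ᵃ[ℝ] Z) :
    iteratedFwdDiff L (fun x => g fun y => σ (f x y)) = 0 := by
  classical
  have := Fintype.ofFinite Y
  have neuron (y : Y) (z : Z) : iteratedFwdDiff L (fun x => σ (f x y) • z) = 0 := by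
    obtain ⟨v, hv, hfv⟩ := hL y
    have apply_add (x : V) : f (x + v) y = f x y := by
      simpa [add_comm, hfv] using congrFun (f.map_vadd x v) y
    exact iteratedFwdDiff_eq_zero_of_mem hv (by funext x; simp [fwdDiff, apply_add])
  have bias : iteratedFwdDiff L (fun _ => g 0) = 0 := by
    obtain ⟨v, hv, -⟩ := hL (Classical.arbitrary Y)
    exact iteratedFwdDiff_eq_zero_of_mem hv (fwdDiff_const v (g 0))
  have layer_eq : (fun x => g fun y => σ (f x y)) =
      ∑ y, (fun x => σ (f x y) • g.linear (Pi.single y 1)) + fun _ => g 0 := by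
    funext x
    simp [affineMap_pi_apply_eq_sum g fun y => σ (f x y)]
  rw [layer_eq, iteratedFwdDiff_add, bias, iteratedFwdDiff_finsetSum,
    Finset.sum_eq_zero fun y _ => neuron y _, add_zero]

theorem iteratedFwdDiff_eq_zero_of_mem_universalityClass [Finite Y] [Nonempty Y]
    [TopologicalSpace V] [TopologicalSpace Z] [IsTopologicalAddGroup Z] [T2Space Z]
    {σ : ℝ → ℝ} {M : Submodule ℝ (V →ᵃ[ℝ] (Y → ℝ))} {N : Submodule ℝ ((Y → ℝ) →ᵃ[ℝ] Z)}
    {L : List V} (hL : ∀ y, ∃ v ∈ L, ∀ f ∈ M, f.linear v y = 0) {η : C(V, Z)}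
    (hη : η ∈ universalityClass σ M N) : iteratedFwdDiff L η = 0 := by
  have hclosed : IsClosed {η : C(V, Z) | iteratedFwdDiff L η = 0} := by
    simp only [funext_iff, Set.ofPred_forall]
    exact isClosed_iInter fun x => isClosed_eq
      ((continuous_iteratedFwdDiff_apply L x).comp continuous_coeFun)
      continuous_const
  refine closure_minimal (Set.iUnion_subset fun h η hη => ?_) hclosed hη
  obtain ⟨f, g, hf, -, hη⟩ := mem_neuralSpace_iff.1 hη
  have eq_sum : (η : V → Z) = ∑ k, fun x => g k fun y => σ (f k x y) := by
    funext x
    rw [hη, Finset.sum_apply]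
  rw [Set.mem_ofPred_eq, eq_sum, iteratedFwdDiff_finsetSum]
  refine Finset.sum_eq_zero fun k _ => iteratedFwdDiff_layer_eq_zero σ (fun y => ?_) (g k)
  obtain ⟨v, hv, hfv⟩ := hL y
  exact ⟨v, hv, hfv _ (hf k)⟩

end Networks

section Separation

variable {G X Y : Type*} [Group G] [MulAction G X] [MulAction G Y]

/-- The equivariant affine map `x ↦ (r x_{α y} + b)_y` attached to an equivariant map `α`. -/
def pullbackAffine (α : Y →[G] X) (r b : ℝ) : (X → ℝ) →ᵃ[ℝ] (Y → ℝ) :=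
  (r • LinearMap.funLeft ℝ ℝ α).toAffineMap + AffineMap.const ℝ (X → ℝ) fun _ => b

theorem pullbackAffine_apply (α : Y →[G] X) (r b : ℝ) (x : X → ℝ) (y : Y) :
    pullbackAffine α r b x y = r * x (α y) + b := by
  simp [pullbackAffine, LinearMap.funLeft_apply]

theorem pullbackAffine_mem_affG (α : Y →[G] X) (r b : ℝ) :
    pullbackAffine α r b ∈ affG (permRep G X) (permRep G Y) := by
  intro g v
  funext y
  simp [permRep, pullbackAffine_apply, LinearMap.funLeft_apply]

/-- The linear functional on `ℝ^Y` that sums all coordinates. -/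
def coordSum (Y : Type*) [Fintype Y] : (Y → ℝ) →ₗ[ℝ] ℝ := ∑ y, LinearMap.proj y

theorem coordSum_mem_affG [Fintype Y] :
    (coordSum Y).toAffineMap ∈ affG (permRep G Y) (Representation.trivial ℝ G ℝ) := by
  intro g v
  simpa [coordSum, permRep, LinearMap.funLeft_apply] using
    Equiv.sum_comp (MulAction.toPerm g⁻¹) v

theorem sum_ridge_eq_of_mem_separationRel [Fintype Y] {σ : ℝ → ℝ} (hσ : Continuous σ)
    (α : Y →[G] X) {x x' : X → ℝ}
    (h : (x, x') ∈ separationRel (universalityClass σ (affG (permRep G X) (permRep G Y))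
      (affG (permRep G Y) (Representation.trivial ℝ G ℝ)))) (r b : ℝ) :
    ∑ y, σ (r * x (α y) + b) = ∑ y, σ (r * x' (α y) + b) := by
  let η : C(X → ℝ, ℝ) := ⟨fun x => ∑ y, σ (r * x (α y) + b), by fun_prop⟩
  refine h η (subset_closure (Set.mem_iUnion.2 ⟨1, mem_neuralSpace_iff.2 ?_⟩))
  exact ⟨fun _ => pullbackAffine α r b, fun _ => (coordSum Y).toAffineMap,
    fun _ => pullbackAffine_mem_affG α r b, fun _ => coordSum_mem_affG,
    fun x => by simp [η, coordSum, pullbackAffine_apply]⟩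

end Separation

/-! ### The symmetrized monomial -/

section SymmetrizedMonomial

variable {X : Type*} {ℓ : ℕ} {α : Fin ℓ → X} {a : Fin ℓ → ℕ}

theorem symmetrizedMonomial_eq_of_perm {x x' : X → ℝ} (π : Equiv.Perm (Fin ℓ))
    (h : ∀ i, x' (α (π i)) = x (α i)) :
    symmetrizedMonomial α a x = symmetrizedMonomial α a x' := by
  simp only [symmetrizedMonomial, ContinuousMap.coe_mk]
  rw [← Equiv.sum_comp (Equiv.mulLeft π) fun τ => ∏ j, x' (α (τ j)) ^ a j]
  simp [h]

/-- The symmetrized monomial as a polynomial in the coordinates of `ℝ^X`. -/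
noncomputable def symmetrizedMonomialPoly (α : Fin ℓ → X) (a : Fin ℓ → ℕ) : MvPolynomial X ℝ :=
  ∑ τ : Equiv.Perm (Fin ℓ), ∏ j, MvPolynomial.X (α (τ j)) ^ a j

theorem eval_symmetrizedMonomialPoly (x : X → ℝ) :
    MvPolynomial.eval x (symmetrizedMonomialPoly α a) = symmetrizedMonomial α a x := by
  simp [symmetrizedMonomialPoly, symmetrizedMonomial]

theorem X_pow_dvd_symmetrizedMonomialPoly {k : ℕ} (ha : ∀ j, k ≤ a j) (i : Fin ℓ) :
    MvPolynomial.X (α i) ^ k ∣ symmetrizedMonomialPoly α a := by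
  refine Finset.dvd_sum fun τ _ => ?_
  calc MvPolynomial.X (α i) ^ k ∣ MvPolynomial.X (α (τ (τ.symm i))) ^ a (τ.symm i) := by
        rw [τ.apply_symm_apply]
        exact pow_dvd_pow _ (ha _)
    _ ∣ ∏ j, MvPolynomial.X (α (τ j)) ^ a j :=
        Finset.dvd_prod_of_mem (fun j => MvPolynomial.X (α (τ j)) ^ a j) (Finset.mem_univ _)

theorem symmetrizedMonomialPoly_ne_zero : symmetrizedMonomialPoly α a ≠ 0 := by
  have eval_one : MvPolynomial.eval 1 (symmetrizedMonomialPoly α a) = (ℓ.factorial : ℝ) := by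
    simp [symmetrizedMonomialPoly, Fintype.card_perm]
  intro h
  rw [h, map_zero] at eval_one
  exact ℓ.factorial_ne_zero (by exact_mod_cast eval_one.symm)

theorem symmetrizedMonomial_not_mem_universalityClass {Y : Type*} {σ : ℝ → ℝ} (hℓ : 0 < ℓ)
    (e : Fin ℓ ≃ Y) {M : Submodule ℝ ((X → ℝ) →ᵃ[ℝ] (Y → ℝ))}
    {N : Submodule ℝ ((Y → ℝ) →ᵃ[ℝ] ℝ)} (ha : ∀ j, ℓ ≤ a j) {c : Fin ℓ → X → ℝ}
    (hc : ∀ i, ∀ f ∈ M, f.linear (c i) (e i) = 0) (hne : ∀ i, ∃ j, c i (α j) ≠ 0) :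
    symmetrizedMonomial α a ∉ universalityClass σ M N := by
  intro hmem
  have : Nonempty Y := ⟨e ⟨0, hℓ⟩⟩
  have : Finite Y := .of_equiv _ e
  have fwdDiff_eq_zero : iteratedFwdDiff (List.ofFn c) (symmetrizedMonomial α a) = 0 :=
    iteratedFwdDiff_eq_zero_of_mem_universalityClass (fun y => ⟨c (e.symm y),
      List.mem_ofFn.2 ⟨_, rfl⟩, fun f hf => by simpa using hc (e.symm y) f hf⟩) hmem
  have polyDiff_eq_zero :
      ((List.ofFn c).map polyDiff).prod (symmetrizedMonomialPoly α a) = 0 := by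
    refine MvPolynomial.funext fun x => ?_
    rw [← congrFun (iteratedFwdDiff_eval (List.ofFn c) _) x,
      funext eval_symmetrizedMonomialPoly, fwdDiff_eq_zero, Pi.zero_apply, map_zero]
  refine symmetrizedMonomialPoly_ne_zero
    (eq_zero_of_polyDiff_prod_eq_zero (A := Set.range α) ?_ ?_ polyDiff_eq_zero)
  · rintro _ ⟨i, rfl⟩
    rw [List.length_ofFn]
    exact X_pow_dvd_symmetrizedMonomialPoly ha i
  · intro v hv
    obtain ⟨i, rfl⟩ := List.mem_ofFn.1 hv
    exact Set.exists_range_iff.2 (hne i)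

end SymmetrizedMonomial

theorem symmetrizedMonomial_mem_respecting {G X Y : Type*} [Group G] [MulAction G X]
    [MulAction G Y] {σ : ℝ → ℝ} (hσ : Continuous σ)
    (hσ_poly : ¬ ∃ p : Polynomial ℝ, ∀ t, σ t = p.eval t) {ℓ : ℕ} (e : Fin ℓ ≃ Y) (α : Y →[G] X)
    (a : Fin ℓ → ℕ) :
    symmetrizedMonomial (fun i => α (e i)) a ∈
      respecting ℝ (separationRel
        (universalityClass σ (affG (permRep G X) (permRep G Y))
          (affG (permRep G Y) (Representation.trivial ℝ G ℝ)))) := by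
  have := Fintype.ofEquiv _ e
  rintro ⟨x, x'⟩ h
  have sum_ridge_eq (r b : ℝ) :
      ∑ i, σ (r * x (α (e i)) + b) = ∑ i, σ (r * x' (α (e i)) + b) := by
    rw [e.sum_comp fun y => σ (r * x (α y) + b), e.sum_comp fun y => σ (r * x' (α y) + b)]
    exact sum_ridge_eq_of_mem_separationRel hσ α h r b
  obtain ⟨π, hπ⟩ := exists_perm_of_sum_ridge_eq hσ hσ_poly sum_ridge_eq
  exact symmetrizedMonomial_eq_of_perm π hπ

/-! ### The combinatorial expression -/

theorem exists_mem_block {ℓ : ℕ} {s : Fin ℓ → ℕ} {p : Fin ℓ} (hp : (p : ℕ) < ∑ j, s j) :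
    ∃ j, p ∈ block s j := by
  let last : Fin ℓ := ⟨ℓ - 1, Nat.sub_one_lt_of_lt p.isLt⟩
  have Iic_last : Finset.Iic last = Finset.univ :=
    Finset.eq_univ_of_forall fun k => Finset.mem_Iic.2 (Nat.le_sub_one_of_lt k.isLt)
  obtain ⟨j, hj, hmin⟩ := (Set.toFinite {j | (p : ℕ) < ∑ k ∈ Finset.Iic j, s k}).exists_minimal
    ⟨last, by rwa [Set.mem_ofPred_eq, Iic_last]⟩
  refine ⟨j, Finset.mem_filter.2 ⟨Finset.mem_univ p, not_lt.1 fun hlt => ?_, hj⟩⟩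
  by_cases hjmin : IsMin j
  · simp [hjmin.finsetIio_eq] at hlt
  · rw [← Finset.Iic_pred_eq_Iio_of_not_isMin hjmin] at hlt
    exact (Order.pred_lt_of_not_isMin hjmin).not_ge (hmin hlt (Order.pred_le j))

theorem exists_ne_zero_of_combinatorialSum_ne_zero {ℓ : ℕ} {s a : Fin ℓ → ℕ}
    (hs : ∑ j, s j = ℓ) {C : Fin ℓ → Fin ℓ → ℝ} (h : combinatorialSum s a C ≠ 0) (i : Fin ℓ) :
    ∃ j, C i j ≠ 0 := by
  obtain ⟨τ, -, hτ⟩ := Finset.exists_ne_zero_of_sum_ne_zero h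
  obtain ⟨j, hj⟩ := exists_mem_block (s := s) (p := τ.symm i) (by rw [hs]; exact Fin.isLt _)
  have block_ne_zero := Finset.prod_ne_zero_iff.1 (right_ne_zero_of_mul hτ) j (Finset.mem_univ j)
  exact ⟨j, by simpa using Finset.prod_ne_zero_iff.1 block_ne_zero _ hj⟩

theorem apply_first_le_of_le_succ {β : Type*} [Preorder β] {ℓ : ℕ} (hℓ : 0 < ℓ) {a : Fin ℓ → β}
    (h : ∀ (i : ℕ) (hi : i + 1 < ℓ), a ⟨i, Nat.lt_of_succ_lt hi⟩ ≤ a ⟨i + 1, hi⟩) (j : Fin ℓ) :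
    a ⟨0, hℓ⟩ ≤ a j := by
  obtain _ | n := ℓ
  · exact j.elim0
  · exact Fin.monotone_iff_le_succ.2 (fun i => h i (Nat.succ_lt_succ i.isLt)) (Fin.zero_le j)

theorem mainTheorem4_general
    {G X Y : Type*} [Group G] [MulAction G X] [MulAction G Y]
    {σ : ℝ → ℝ} (hσ : Continuous σ) (hσ_poly : ¬ ∃ p : Polynomial ℝ, ∀ t, σ t = p.eval t)
    {ℓ : ℕ} (hℓ : 0 < ℓ) (e : Fin ℓ ≃ Y) (α : Y →[G] X) {a : Fin ℓ → ℕ} (ha : ∀ j, ℓ ≤ a j)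
    {c : Fin ℓ → X → ℝ}
    (hc : ∀ i, ∀ f ∈ affG (permRep G X) (permRep G Y), f.linear (c i) (e i) = 0)
    (hne : ∀ i, ∃ j, c i (α (e j)) ≠ 0) :
    ¬ IsSeparationConstrainedUniversal
        (universalityClass σ (affG (permRep G X) (permRep G Y))
          (affG (permRep G Y) (Representation.trivial ℝ G ℝ))) ∧
      symmetrizedMonomial (fun i => α (e i)) a ∈
        respecting ℝ (separationRel
          (universalityClass σ (affG (permRep G X) (permRep G Y))
            (affG (permRep G Y) (Representation.trivial ℝ G ℝ)))) ∧
      symmetrizedMonomial (fun i => α (e i)) a ∉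
        universalityClass σ (affG (permRep G X) (permRep G Y))
          (affG (permRep G Y) (Representation.trivial ℝ G ℝ)) := by
  have hmem := symmetrizedMonomial_mem_respecting hσ hσ_poly e α a
  have hnot := symmetrizedMonomial_not_mem_universalityClass (σ := σ)
    (N := affG (permRep G Y) (Representation.trivial ℝ G ℝ)) hℓ e ha hc hne
  refine ⟨fun huniv => hnot ?_, hmem, hnot⟩
  rw [IsSeparationConstrainedUniversal, universalityClass, closure_closure] at huniv
  rw [universalityClass, huniv]
  exact hmem

theorem mainTheorem4
    {G : Type*} [Group G] [Finite G]
    {X : Type*} [Finite X] [MulAction G X]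
    {Y : Type*} [Finite Y] [MulAction G Y]
    -- a continuous, non-polynomial activation function
    (σ : ℝ → ℝ) (hσ : Continuous σ)
    (hσ_poly : ¬ ∃ p : Polynomial ℝ, ∀ t, σ t = p.eval t)
    -- `Y` is identified with `[ℓ]`
    {ℓ : ℕ} (hℓ : 0 < ℓ) (e : Fin ℓ ≃ Y)
    -- a basis of the linear part of `M = Aff_G(ℝ^X, ℝ^Y)`
    {m : ℕ} (φ : Module.Basis (Fin m) ℝ (linearPart (affG (permRep G X) (permRep G Y))))
    -- `α_i = α (e i)`; equivariance says that `x ↦ (x_{α_1}, …, x_{α_ℓ})` is in `Hom_G(ℝ^X, ℝ^Y)`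
    (α : Y →[G] X)
    (s : Fin ℓ → ℕ) (hs : ∑ j, s j = ℓ)
    (a : Fin ℓ → ℕ) (ha_first : ℓ < a ⟨0, hℓ⟩)
    (ha_gap : ∀ (i : ℕ) (hi : i + 1 < ℓ), a ⟨i, Nat.lt_of_succ_lt hi⟩ + ℓ < a ⟨i + 1, hi⟩)
    (c : Fin ℓ → X → ℝ) (hc : ∀ i, c i ∈ LinearMap.ker (basisMap φ (e i)))
    (hne : combinatorialSum s a (fun i j => c i (α (e j))) ≠ 0) :
    ¬ IsSeparationConstrainedUniversal
        (universalityClass σ (affG (permRep G X) (permRep G Y))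
          (affG (permRep G Y) (Representation.trivial ℝ G ℝ))) ∧
      symmetrizedMonomial (fun i => α (e i)) a ∈
        respecting ℝ (separationRel
          (universalityClass σ (affG (permRep G X) (permRep G Y))
            (affG (permRep G Y) (Representation.trivial ℝ G ℝ)))) ∧
      symmetrizedMonomial (fun i => α (e i)) a ∉
        universalityClass σ (affG (permRep G X) (permRep G Y))
          (affG (permRep G Y) (Representation.trivial ℝ G ℝ)) := by
  have ha (j : Fin ℓ) : ℓ ≤ a j := ha_first.le.trans <|
    apply_first_le_of_le_succ hℓ (fun i hi => (Nat.le_add_right _ ℓ).trans (ha_gap i hi).le) j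
  exact mainTheorem4_general hσ hσ_poly hℓ e α ha
    (fun i _ => linear_apply_eq_zero_of_mem_ker_basisMap φ (hc i))
    (exists_ne_zero_of_combinatorialSum_ne_zero hs hne)
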